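/- **Model.** Each of $n$ users is placed independently and uniformly at random in the unit square and never moves. Time is slotted. In every slot each node is, independently, a sender with probability $\theta\in(0,\tfrac12)$ and a potential receiver otherwise; every sender $i$ attempts to transmit one packet to its nearest potential receiver $j(i)$. The transmission succeeds if and only if $$\mathrm{SINR}_{i,j(i)}=\frac{P\,r_{i,j(i)}^{-\alpha}}{\eta+\sum_{l\ne i,\ l\text{ a sender}}P\,r_{l,j(i)}^{-\alpha}}\ \ge\ \beta ,$$ where $r_{ij}$ is the Euclidean distance between nodes $i$ and $j$, and $P>0$, $\alpha>2$, $\eta>0$, $\beta>0$, $\theta$ are constants independent of $n$. If several packets addressed to the same node succeed in the same slot (which is impossible if $\beta\ge 1$), the node stores a subset of them (for instance all, or just one of them), determined by an arbitrary fixed rule. Under RANDOM PUSH, a sender transmits a message chosen uniformly at random among the messages it possesses at that moment. The designations of the nodes and the messages chosen are, given the past, independent over the nodes. **Theorem.** Let $w=w(n)$ be integers with $w=\omega(\mathrm{polylog}\,n)$, that is, $(\log n)^c/w(n)\to0$ for every $c\ge 0$. Suppose that there are $k\le n$ distinct messages, and that a new message $M^*$, arriving later than the other $k-1$ messages, is injected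 at a single node at a moment when every node already possesses at least $w$ of the other $k-1$ messages (the set of messages held by each node at this moment may be random and may depend on the locations of the nodes). Let $T^*$ be the number of slots after the injection until every node possesses $M^*$ (with $T^*=\infty$ if this never happens) under RANDOM PUSH. Then for every constant $\epsilon>0$ and all sufficiently large $n$, $$\mathbb P\left(T^*>w^{1-\epsilon}\sqrt{\frac{n}{128\log n}}\right)>1-n^{-2},$$ where how large $n$ must be depends only on $\epsilon$, the function $w$ and the constants $P,\alpha,\eta,\beta,\theta$. -/

import Mathlib

open MeasureTheory ProbabilityTheory Filter Topology
open scoped ENNReal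

noncomputable section

namespace Gossip

/-- The Euclidean plane, in which the users live. -/
abbrev Plane : Type := EuclideanSpace ℝ (Fin 2)

/-- The square of unit area. -/
def unitSquare : Set Plane := {x | ∀ c, x c ∈ Set.Icc (0 : ℝ) 1}

/-- The constants of the wireless network, none of which depends on the number of users. -/
structure Radio where
  /-- common transmission power -/
  power : ℝ
  /-- path loss exponent -/
  pathLoss : ℝ
  /-- noise power -/
  noise : ℝ
  /-- SINR threshold required for a successful reception -/
  threshold : ℝ
  /-- probability with which a node is designated as a sender in a slot -/
  sendProb : ℝ
  power_pos : 0 < power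
  two_lt_pathLoss : 2 < pathLoss
  noise_pos : 0 < noise
  threshold_pos : 0 < threshold
  sendProb_pos : 0 < sendProb
  sendProb_lt : sendProb < 1 / 2

variable {n k : ℕ}

/-- What the nodes do in one time slot: `none` means that the node is a potential receiver,
`some c` means that it is a sender and transmits the message `c`. -/
abbrev Action (n k : ℕ) : Type := Fin n → Option (Fin k)

/-- Which messages each node possesses. -/
abbrev Holdings (n k : ℕ) : Type := Fin n → Finset (Fin k)

/-- The set of transmitters of a slot. -/
def senders (a : Action n k) : Finset (Fin n) := Finset.univ.filter fun i => a i ≠ none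

/-- The power with which `j` receives the signal of transmitter `i`. -/
def Radio.signal (R : Radio) (x : Fin n → Plane) (i j : Fin n) : ℝ :=
  R.power * dist (x i) (x j) ^ (-R.pathLoss)

/-- The signal-to-interference-plus-noise ratio at `j` of the signal of transmitter `i`. -/
def Radio.sinr (R : Radio) (x : Fin n → Plane) (a : Action n k) (i j : Fin n) : ℝ :=
  R.signal x i j / (R.noise + ∑ l ∈ (senders a).erase i, R.signal x l j)

/-- `i` is a sender and `j` is its nearest potential receiver. -/
def IsLink (x : Fin n → Plane) (a : Action n k) (i j : Fin n) : Prop :=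
  a i ≠ none ∧ a j = none ∧ ∀ l, a l = none → dist (x i) (x j) ≤ dist (x i) (x l)

open Classical in
/-- The senders that attempt to transmit to `j` in this slot and whose SINR at `j` reaches the
threshold. -/
def Radio.decodable (R : Radio) (x : Fin n → Plane) (a : Action n k) (j : Fin n) :
    Finset (Fin n) :=
  Finset.univ.filter fun i => IsLink x a i j ∧ R.threshold ≤ R.sinr x a i j

/-- A reception rule: it says which of the decodable packets addressed to node `j` are stored by
`j`. With `keep j s = s` all of them are stored; the rules with `(keep j s).card ≤ 1` express that
a node can receive at most one message per slot. For a threshold of at least `1` no two packets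
are decodable at the same node in the same slot. -/
abbrev ReceptionRule (n : ℕ) : Type := Fin n → Finset (Fin n) → Finset (Fin n)

/-- The evolution of the holdings in one time slot. -/
def Radio.step (R : Radio) (keep : ReceptionRule n) (x : Fin n → Plane) (a : Action n k)
    (h : Holdings n k) : Holdings n k :=
  fun j => h j ∪ (keep j (R.decodable x a j)).biUnion fun i => (a i).toFinset

/-- The holdings after `t` slots, in a static network with locations `x` and initial holdings
`h₀`, when the nodes do `a s` in slot `s`. -/
def Radio.holdings (R : Radio) (keep : ReceptionRule n) (x : Fin n → Plane) (h₀ : Holdings n k)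
    (a : ℕ → Action n k) : ℕ → Holdings n k
  | 0 => h₀
  | t + 1 => R.step keep x (a t) (R.holdings keep x h₀ a t)

/-- The first time at which every node possesses the message `c` (`⊤` if there is none). -/
def Radio.spreadTime (R : Radio) (keep : ReceptionRule n) (x : Fin n → Plane)
    (h₀ : Holdings n k) (a : ℕ → Action n k) (c : Fin k) : ℕ∞ :=
  ⨅ (t : ℕ) (_ : ∀ i, c ∈ R.holdings keep x h₀ a t i), (t : ℕ∞)

/-- The probability, under UNICAST and RANDOM PUSH, that a node possessing the set `s` of messages
does `b`: it is a sender with probability `θ`, and a sender selects uniformly at random one of the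
messages that it possesses. -/
def pushProb (θ : ℝ) (s : Finset (Fin k)) (b : Option (Fin k)) : ℝ :=
  b.elim (1 - θ) fun c => if c ∈ s then θ / s.card else 0

/-- `X` (locations), `H₀` (initial holdings) and `act` (actions in the slots `0, 1, …`) form a
RANDOM PUSH process over a static random network. The σ-algebra `ℱ t` describes the past of
slot `t`. The initial holdings may depend on the locations in an arbitrary way. -/
structure IsRandomPush {Ω : Type*} [mΩ : MeasurableSpace Ω] (μ : Measure Ω) (R : Radio)
    (keep : ReceptionRule n) (ℱ : Filtration ℕ mΩ) (X : Fin n → Ω → Plane)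
    (H₀ : Ω → Holdings n k) (act : ℕ → Ω → Action n k) : Prop where
  measurable_loc : ∀ i, Measurable[ℱ 0] (X i)
  measurable_init : ∀ h, MeasurableSet[ℱ 0] {ω | H₀ ω = h}
  measurable_act : ∀ t a, MeasurableSet[ℱ (t + 1)] {ω | act t ω = a}
  /-- the users are placed independently … -/
  indep_loc : iIndepFun X μ
  /-- … and uniformly over the unit square -/
  uniform_loc : ∀ i, μ.map (X i) = volume.restrict unitSquare
  /-- given the past, the nodes act independently of each other -/
  cond_act : ∀ t a, μ⟦{ω | act t ω = a}|ℱ t⟧ =ᵐ[μ] fun ω =>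
    ∏ i, pushProb R.sendProb
      (R.holdings keep (fun l => X l ω) (H₀ ω) (fun s => act s ω) t i) (a i)

/-- `w(n) = ω(polylog n)`: `w` grows faster than every power of `log n`. -/
def SuperPolylog (w : ℕ → ℕ) : Prop :=
  ∀ c : ℕ, (fun n : ℕ => Real.log n ^ c) =o[atTop] fun n : ℕ => (w n : ℝ)

end Gossip

end

namespace Gossip

variable {n k : ℕ}

/-! ### Deterministic facts about the dynamics -/

/-! The new message competes with at least `w` older ones at every node, so in each slot a given
node transmits it with conditional probability at most `θ / w`; and each transmission carries it
only over a short distance. Cut the square into `m ^ 2` cells with `m` about `√(n / log n) / 4`. A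
cell then has mean population at least `16 log n`, so with high probability every cell contains a
potential receiver in every slot considered (`measure_all_senders_le`), and all links have length at
most `2 / m`. SINR and the reception rule can only suppress transmissions, so the informed nodes lie
in `shortReach` (`mem_shortReach_of_mem_holdings`).

The spread of `shortReach` is controlled by an exponential moment, as for a branching random walk.
Sum `exp (l * d)` over reached nodes, `d` being the distance to the source. A transmitter almost
surely has one nearest receiver, so it adds at most `exp (l * r)` times its own weight; the mean
thus grows per slot by a factor at most `1 + exp (l * r) * θ / w` (`lintegral_potential_le`).
Markov's inequality bounds the chance of reaching distance `1 / 4` (`measure_far_le`). Informing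
everybody requires this, since nodes exist near opposite sides of the square. With `l = m / 2` the
bound is `exp (-m / 8 + O(T / w))`, negligible for the claimed `T`. -/

/-- The nodes reached from the node `s` by successive transmissions of the message `c` over links
of length at most `r`. -/
def shortReach (r : ℝ) (x : Fin n → Plane) (a : ℕ → Action n k) (c : Fin k) (s : Fin n) :
    ℕ → Set (Fin n)
  | 0 => {s}
  | t + 1 => shortReach r x a c s t ∪
      {j | ∃ i ∈ shortReach r x a c s t, a t i = some c ∧ IsLink x (a t) i j ∧
        dist (x i) (x j) ≤ r}

theorem Radio.holdings_subset_succ (R : Radio) (keep : ReceptionRule n) (x : Fin n → Plane)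
    (h₀ : Holdings n k) (a : ℕ → Action n k) (t : ℕ) (i : Fin n) :
    R.holdings keep x h₀ a t i ⊆ R.holdings keep x h₀ a (t + 1) i :=
  Finset.subset_union_left

theorem Radio.holdings_mono (R : Radio) (keep : ReceptionRule n) (x : Fin n → Plane)
    (h₀ : Holdings n k) (a : ℕ → Action n k) (i : Fin n) :
    Monotone fun t => R.holdings keep x h₀ a t i :=
  monotone_nat_of_le_succ fun t => R.holdings_subset_succ keep x h₀ a t i

/-- Induction on time: a stored packet was decodable, hence came over a link, and its sender already
possessed the message. -/
theorem mem_shortReach_of_mem_holdings (R : Radio) {keep : ReceptionRule n}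
    (hkeep : ∀ j s, keep j s ⊆ s) {x : Fin n → Plane} {h₀ : Holdings n k} {a : ℕ → Action n k}
    {c : Fin k} {s : Fin n} {r : ℝ} (hs : ∀ i, c ∈ h₀ i → i = s)
    (ha : ∀ u i, a u i = some c → c ∈ R.holdings keep x h₀ a u i) (t : ℕ)
    (hr : ∀ u < t, ∀ i j, IsLink x (a u) i j → dist (x i) (x j) ≤ r) (j : Fin n)
    (hj : c ∈ R.holdings keep x h₀ a t j) : j ∈ shortReach r x a c s t := by
  classical
  induction t generalizing j with
  | zero => exact hs j hj
  | succ t ih =>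
    have ih' := ih fun u hu => hr u (hu.trans t.lt_succ_self)
    rcases Finset.mem_union.1 hj with hj | hj
    · exact Or.inl (ih' j hj)
    · obtain ⟨i, hi, hc⟩ := Finset.mem_biUnion.1 hj
      have hd := (Finset.mem_filter.1 (hkeep _ _ hi)).2
      have hai : a t i = some c := by simpa using hc
      exact Or.inr ⟨i, ih' i (ha t i hai), hai, hd.1, hr t t.lt_succ_self i j hd.1⟩

theorem Radio.exists_le_of_spreadTime_le (R : Radio) {keep : ReceptionRule n}
    {x : Fin n → Plane} {h₀ : Holdings n k} {a : ℕ → Action n k} {c : Fin k} {B : ℝ} (hB : 0 ≤ B)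
    (h : (R.spreadTime keep x h₀ a c : ℝ≥0∞) ≤ ENNReal.ofReal B) :
    ∀ i, c ∈ R.holdings keep x h₀ a ⌊B⌋₊ i := by
  by_contra hne
  -- Holdings only grow, so a node lacking `c` at time `⌊B⌋₊` rules out all earlier times; the
  -- infimum then exceeds `B`.
  have hlt : ((⌊B⌋₊ + 1 : ℕ) : ℕ∞) ≤ R.spreadTime keep x h₀ a c := by
    refine le_iInf₂ fun t ht => ?_
    by_contra hlt
    have htB : t ≤ ⌊B⌋₊ := by
      have : t < ⌊B⌋₊ + 1 := by exact_mod_cast not_le.1 hlt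
      omega
    exact hne fun i => R.holdings_mono keep x h₀ a i htB (ht i)
  have h1 : ((⌊B⌋₊ + 1 : ℕ) : ℝ≥0∞) ≤ ENNReal.ofReal B := by
    refine le_trans ?_ h
    exact_mod_cast (ENat.toENNReal_le.2 hlt)
  rw [← ENNReal.ofReal_natCast, ENNReal.ofReal_le_ofReal_iff hB] at h1
  exact absurd (Nat.lt_floor_add_one B) (not_lt.2 (by exact_mod_cast h1))

/-! ### The RANDOM PUSH law of a single node -/

theorem pushProb_nonneg {θ : ℝ} (h0 : 0 ≤ θ) (h1 : θ ≤ 1) (s : Finset (Fin k))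
    (b : Option (Fin k)) : 0 ≤ pushProb θ s b := by
  cases b with
  | none => simpa [pushProb] using h1
  | some c => simp only [pushProb, Option.elim]; positivity

/-- Equality can fail: for empty `s` no message can be selected and the sum is zero. -/
theorem sum_pushProb_some_le {θ : ℝ} (h0 : 0 ≤ θ) (s : Finset (Fin k)) :
    ∑ c, pushProb θ s (some c) ≤ θ := by
  rcases s.eq_empty_or_nonempty with rfl | hs
  · simpa [pushProb] using h0
  · have : (s.card : ℝ) ≠ 0 := by exact_mod_cast hs.card_pos.ne'
    simp only [pushProb, Option.elim, Finset.sum_ite_mem, Finset.univ_inter, Finset.sum_const,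
      nsmul_eq_mul]
    rw [mul_div_cancel₀ _ this]

theorem sum_pushProb_le_one {θ : ℝ} (h0 : 0 ≤ θ) (s : Finset (Fin k)) :
    ∑ b, pushProb θ s b ≤ 1 := by
  have := sum_pushProb_some_le h0 s
  rw [Fintype.sum_option]
  simp only [pushProb, Option.elim] at this ⊢
  linarith

theorem pushProb_some_le {θ : ℝ} (h0 : 0 ≤ θ) {w : ℕ} (hw : 0 < w) {s : Finset (Fin k)}
    (hs : w ≤ s.card) (c : Fin k) : pushProb θ s (some c) ≤ θ / w := by
  simp only [pushProb, Option.elim]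
  split_ifs
  · gcongr
  · positivity

/-! ### The actions of a slot, given the past -/

variable {Ω : Type*} [mΩ : MeasurableSpace Ω] {μ : Measure Ω} {R : Radio}
  {keep : ReceptionRule n} {ℱ : Filtration ℕ mΩ} {X : Fin n → Ω → Plane}
  {H₀ : Ω → Holdings n k} {act : ℕ → Ω → Action n k}

/-- The messages that node `i` possesses before slot `t`. -/
noncomputable abbrev past (R : Radio) (keep : ReceptionRule n) (X : Fin n → Ω → Plane)
    (H₀ : Ω → Holdings n k) (act : ℕ → Ω → Action n k) (t : ℕ) (ω : Ω) : Holdings n k :=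
  R.holdings keep (fun l => X l ω) (H₀ ω) (fun s => act s ω) t

namespace IsRandomPush

theorem measurableSet_act_eq (hP : IsRandomPush μ R keep ℱ X H₀ act) (t : ℕ) (a : Action n k) :
    MeasurableSet {ω | act t ω = a} :=
  ℱ.le _ _ (hP.measurable_act t a)

/-- Integrating the conditional law over an event of the past turns a pointwise bound on the product
weights into a bound on probabilities; the later estimates on actions rest on this. -/
theorem measureReal_inter_act_le [IsProbabilityMeasure μ]
    (hP : IsRandomPush μ R keep ℱ X H₀ act) (t : ℕ)
    {A : Set Ω} (hA : MeasurableSet[ℱ t] A) (S : Finset (Action n k)) (q : ℝ)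
    (hq : ∀ᵐ ω ∂μ, ω ∈ A →
      ∑ a ∈ S, ∏ i, pushProb R.sendProb (past R keep X H₀ act t ω i) (a i) ≤ q) :
    μ.real (A ∩ {ω | act t ω ∈ S}) ≤ q * μ.real A := by
  have hA' : MeasurableSet A := ℱ.le _ _ hA
  have hU : A ∩ {ω | act t ω ∈ S} = ⋃ a ∈ S, A ∩ {ω | act t ω = a} := by
    ext ω; simp
  have hint : ∀ a, Integrable ({ω | act t ω = a}.indicator fun _ => (1 : ℝ)) μ := fun a =>
    (integrable_const 1).indicator (hP.measurableSet_act_eq t a)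
  have hone : ∀ a, μ.real (A ∩ {ω | act t ω = a}) =
      ∫ ω in A, (μ⟦{ω | act t ω = a}|ℱ t⟧) ω ∂μ := fun a => by
    rw [setIntegral_condExp (ℱ.le t) (hint a) hA,
      integral_indicator_const _ (hP.measurableSet_act_eq t a), smul_eq_mul, mul_one,
      measureReal_restrict_apply (hP.measurableSet_act_eq t a), Set.inter_comm]
  rw [hU, measureReal_biUnion_finset]
  · simp_rw [hone]
    rw [← integral_finsetSum _ fun a _ => integrable_condExp.integrableOn]
    calc ∫ ω in A, ∑ a ∈ S, (μ⟦{ω | act t ω = a}|ℱ t⟧) ω ∂μ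
        ≤ ∫ _ in A, q ∂μ := by
          refine setIntegral_mono_on_ae
            (integrable_finsetSum _ fun a _ => integrable_condExp.integrableOn)
            (integrable_const q) hA' ?_
          have hall := ae_all_iff.2 fun a => hP.cond_act t a
          filter_upwards [hall, hq] with ω h1 h2 hω
          simp_rw [h1]
          exact h2 hω
      _ = q * μ.real A := by simp [mul_comm]
  · intro a _ b _ hab
    refine Set.disjoint_left.2 fun ω h1 h2 => hab (h1.2.symm.trans h2.2)
  · exact fun a _ => hA'.inter (hP.measurableSet_act_eq t a)

theorem measure_inter_act_le [IsProbabilityMeasure μ]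
    (hP : IsRandomPush μ R keep ℱ X H₀ act) (t : ℕ)
    {A : Set Ω} (hA : MeasurableSet[ℱ t] A) (S : Finset (Action n k)) (q : ℝ) (hq0 : 0 ≤ q)
    (hq : ∀ᵐ ω ∂μ, ω ∈ A →
      ∑ a ∈ S, ∏ i, pushProb R.sendProb (past R keep X H₀ act t ω i) (a i) ≤ q) :
    μ (A ∩ {ω | act t ω ∈ S}) ≤ ENNReal.ofReal q * μ A := by
  have := hP.measureReal_inter_act_le t hA S q hq
  rw [← ofReal_measureReal (s := A), ← ENNReal.ofReal_mul hq0, ← ofReal_measureReal]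
  exact ENNReal.ofReal_le_ofReal this

theorem ae_mem_past [IsProbabilityMeasure μ] (hP : IsRandomPush μ R keep ℱ X H₀ act) :
    ∀ᵐ ω ∂μ, ∀ t i c, act t ω i = some c → c ∈ past R keep X H₀ act t ω i := by
  have key : ∀ t a, ∀ᵐ ω ∂μ, act t ω = a →
      ∏ i, pushProb R.sendProb (past R keep X H₀ act t ω i) (a i) ≠ 0 := fun t a => by
    -- The zero set is taken for the conditional expectation, whose `ℱ t`-measurability is
    -- automatic, instead of for the product of weights, which agrees with it almost everywhere.
    set g := μ⟦{ω | act t ω = a}|ℱ t⟧ with hg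
    have hA : MeasurableSet[ℱ t] {ω | g ω = 0} :=
      stronglyMeasurable_condExp.measurable (measurableSet_singleton 0)
    have h0 := hP.measure_inter_act_le t hA {a} 0 le_rfl (by
      filter_upwards [hP.cond_act t a] with ω h1 h2
      rw [Finset.sum_singleton]
      exact (h1.symm.trans h2).le)
    rw [ENNReal.ofReal_zero, zero_mul, nonpos_iff_eq_zero] at h0
    filter_upwards [hP.cond_act t a, measure_eq_zero_iff_ae_notMem.1 h0] with ω h1 h2 h3 h4
    exact h2 ⟨h1.trans h4, by simpa using h3⟩
  have hall := ae_all_iff.2 fun t => ae_all_iff.2 fun a => key t a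
  filter_upwards [hall] with ω hω t i c hc
  have := Finset.prod_ne_zero_iff.1 (hω t (act t ω) rfl) i (Finset.mem_univ i)
  rw [hc] at this
  by_contra hcon
  exact this (by simp only [pushProb, Option.elim]; exact if_neg hcon)

/-- Summing out the other nodes costs a factor at most one, and holdings never fall below their
initial size. -/
theorem measure_inter_transmits_le [IsProbabilityMeasure μ]
    (hP : IsRandomPush μ R keep ℱ X H₀ act) {w : ℕ} (hw : 0 < w)
    (hH : ∀ᵐ ω ∂μ, ∀ i, w ≤ (H₀ ω i).card) (t : ℕ) (i : Fin n) (c : Fin k)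
    {A : Set Ω} (hA : MeasurableSet[ℱ t] A) :
    μ (A ∩ {ω | act t ω i = some c}) ≤ ENNReal.ofReal (R.sendProb / w) * μ A := by
  classical
  have h0 := R.sendProb_pos.le
  have h1 : R.sendProb ≤ 1 := by linarith [R.sendProb_lt]
  let B : Fin n → Finset (Option (Fin k)) := fun l => if l = i then {some c} else Finset.univ
  refine le_trans (measure_mono ?_) (hP.measure_inter_act_le t hA (Fintype.piFinset B) _
    (by positivity) ?_)
  · rintro ω ⟨hω, hc⟩
    refine ⟨hω, Fintype.mem_piFinset.2 fun l => ?_⟩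
    by_cases hl : l = i
    · subst hl; simpa [B] using hc
    · simp [B, hl]
  · filter_upwards [hH] with ω hω _
    rw [← Finset.prod_univ_sum B fun l b => pushProb R.sendProb (past R keep X H₀ act t ω l) b,
      ← Finset.mul_prod_erase _ _ (Finset.mem_univ i)]
    refine (mul_le_of_le_one_right (Finset.sum_nonneg fun _ _ => pushProb_nonneg h0 h1 _ _)
      (Finset.prod_le_one (fun l _ => Finset.sum_nonneg fun _ _ => pushProb_nonneg h0 h1 _ _)
        fun l hl => ?_)).trans ?_
    · simp only [B, if_neg (Finset.ne_of_mem_erase hl)]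
      exact sum_pushProb_le_one h0 _
    · simp only [B, if_true, Finset.sum_singleton]
      exact pushProb_some_le h0 hw ((hω i).trans (Finset.card_le_card
        (R.holdings_mono keep _ _ _ i (Nat.zero_le t)))) c

theorem measure_inter_senders_le [IsProbabilityMeasure μ]
    (hP : IsRandomPush μ R keep ℱ X H₀ act) (t : ℕ)
    (S : Finset (Fin n)) {A : Set Ω} (hA : MeasurableSet[ℱ t] A) :
    μ (A ∩ {ω | ∀ i ∈ S, act t ω i ≠ none}) ≤ ENNReal.ofReal R.sendProb ^ S.card * μ A := by
  classical
  have h0 := R.sendProb_pos.le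
  have h1 : R.sendProb ≤ 1 := by linarith [R.sendProb_lt]
  let B : Fin n → Finset (Option (Fin k)) := fun l =>
    if l ∈ S then Finset.univ.map Function.Embedding.some else Finset.univ
  rw [← ENNReal.ofReal_pow h0]
  refine le_trans (measure_mono ?_) (hP.measure_inter_act_le t hA (Fintype.piFinset B) _
    (by positivity) ?_)
  · rintro ω ⟨hω, hc⟩
    refine ⟨hω, Fintype.mem_piFinset.2 fun l => ?_⟩
    by_cases hl : l ∈ S
    · obtain ⟨b, hb⟩ := Option.ne_none_iff_exists'.1 (hc l hl)
      simp [B, hl, hb]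
    · simp [B, hl]
  · refine ae_of_all _ fun ω _ => ?_
    rw [← Finset.prod_univ_sum B fun l b => pushProb R.sendProb (past R keep X H₀ act t ω l) b,
      ← Finset.prod_const]
    calc _ ≤ ∏ l, if l ∈ S then R.sendProb else 1 := by
          refine Finset.prod_le_prod
            (fun l _ => Finset.sum_nonneg fun _ _ => pushProb_nonneg h0 h1 _ _) fun l _ => ?_
          by_cases hl : l ∈ S
          · simp only [B, if_pos hl, Finset.sum_map]
            exact sum_pushProb_some_le h0 _
          · simp only [B, if_neg hl]
            exact sum_pushProb_le_one h0 _
      _ = ∏ l ∈ S, R.sendProb := by rw [Finset.prod_ite_mem, Finset.univ_inter]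
      _ ≤ _ := le_rfl

end IsRandomPush

theorem measurable_plane_dist {Ω : Type*} {m : MeasurableSpace Ω} {f g : Ω → Plane}
    (hf : Measurable f) (hg : Measurable g) : Measurable fun ω => dist (f ω) (g ω) :=
  hf.dist hg

namespace IsRandomPush

/-! ### Distances between the nodes -/

theorem measurable_loc_at (hP : IsRandomPush μ R keep ℱ X H₀ act) (t : ℕ) (i : Fin n) :
    Measurable[ℱ t] (X i) :=
  (hP.measurable_loc i).mono (ℱ.mono (Nat.zero_le t)) le_rfl

theorem measurable_loc' (hP : IsRandomPush μ R keep ℱ X H₀ act) (i : Fin n) : Measurable (X i) :=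
  (hP.measurable_loc i).mono (ℱ.le 0) le_rfl

theorem measurable_dist_at (hP : IsRandomPush μ R keep ℱ X H₀ act) (t : ℕ) (i j : Fin n) :
    Measurable[ℱ t] fun ω => dist (X i ω) (X j ω) :=
  measurable_plane_dist (hP.measurable_loc_at t i) (hP.measurable_loc_at t j)

theorem ae_mem_unitSquare (hP : IsRandomPush μ R keep ℱ X H₀ act) :
    ∀ᵐ ω ∂μ, ∀ i, X i ω ∈ unitSquare := by
  refine ae_all_iff.2 fun i => ?_
  refine ae_of_ae_map (p := fun y => y ∈ unitSquare) (hP.measurable_loc' i).aemeasurable ?_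
  rw [hP.uniform_loc i]
  refine ae_restrict_mem ?_
  have : unitSquare = ⋂ c : Fin 2, (fun x : Plane => x c) ⁻¹' Set.Icc 0 1 := by
    ext x; simp [unitSquare]
  rw [this]
  exact MeasurableSet.iInter fun c => (by fun_prop : Measurable fun x : Plane => x c) measurableSet_Icc

/-- Given `X i` and `X l`, a tie puts the independent point `X j` on a sphere, which is a null set.
The case `l = i` is included, with radius zero. -/
theorem ae_dist_ne [IsProbabilityMeasure μ] (hP : IsRandomPush μ R keep ℱ X H₀ act) :
    ∀ᵐ ω ∂μ, ∀ i j l, i ≠ j → l ≠ j → dist (X i ω) (X j ω) ≠ dist (X i ω) (X l ω) := by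
  refine ae_all_iff.2 fun i => ae_all_iff.2 fun j => ae_all_iff.2 fun l => ?_
  by_cases hij : i = j
  · exact ae_of_all _ fun _ h => absurd hij h
  by_cases hlj : l = j
  · exact ae_of_all _ fun _ _ h => absurd hlj h
  have hm := hP.measurable_loc'
  have hind := hP.indep_loc.indepFun_prodMk hm i l j hij hlj
  have hpair : Measurable fun ω => (X i ω, X l ω) := (hm i).prodMk (hm l)
  rw [indepFun_iff_map_prod_eq_prod_map_map hpair.aemeasurable (hm j).aemeasurable] at hind
  have : IsProbabilityMeasure (μ.map (X j)) := Measure.isProbabilityMeasure_map (hm j).aemeasurable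
  let T : Set ((Plane × Plane) × Plane) := {z | dist z.1.1 z.2 = dist z.1.1 z.1.2}
  have hT : MeasurableSet T := measurableSet_eq_fun (by fun_prop) (by fun_prop)
  have h0 : (μ.map fun ω => ((X i ω, X l ω), X j ω)) T = 0 := by
    rw [hind, Measure.measure_prod_null hT]
    refine ae_of_all _ fun z => ?_
    rw [hP.uniform_loc j]
    have : Prod.mk z ⁻¹' T = Metric.sphere z.1 (dist z.1 z.2) := by
      ext y; rw [Metric.mem_sphere, dist_comm]; rfl
    simp only [this, Pi.zero_apply]
    exact Measure.absolutelyContinuous_of_le Measure.restrict_le_self (Measure.addHaar_sphere _ _ _)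
  rw [Measure.map_apply (hpair.prodMk (hm j)) hT] at h0
  filter_upwards [measure_eq_zero_iff_ae_notMem.1 h0] with ω hω _ _ h
  exact hω h

/-! ### Cells all of whose nodes are senders -/

/-- Split according to the set `S` of nodes located in `Q`, an event of the past. The binomial sum
of `(θ * p) ^ |S| * (1 - p) ^ (n - |S|)` gives the bound. -/
theorem measure_all_senders_le [IsProbabilityMeasure μ] (hP : IsRandomPush μ R keep ℱ X H₀ act)
    (t : ℕ) {Q : Set Plane} (hQ : MeasurableSet Q) {p : ℝ}
    (hp : volume.restrict unitSquare Q = ENNReal.ofReal p) (hp0 : 0 ≤ p) (hp1 : p ≤ 1) :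
    μ {ω | ∀ i, X i ω ∈ Q → act t ω i ≠ none} ≤
      ENNReal.ofReal ((1 - (1 - R.sendProb) * p) ^ n) := by
  classical
  let U : Finset (Fin n) → Fin n → Set Plane := fun S i => if i ∈ S then Q else Qᶜ
  have hU : ∀ S i, MeasurableSet (U S i) := fun S i => by
    by_cases h : i ∈ S
    · simpa [U, h] using hQ
    · simpa [U, h] using hQ.compl
  let A : Finset (Fin n) → Set Ω := fun S => ⋂ i ∈ Finset.univ, X i ⁻¹' U S i
  have hA : ∀ S, MeasurableSet[ℱ t] (A S) := fun S =>
    @Finset.measurableSet_biInter _ _ (ℱ t) _ _ fun i _ => hP.measurable_loc_at t i (hU S i)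
  have hin : ∀ i, μ (X i ⁻¹' Q) = ENNReal.ofReal p := fun i => by
    rw [← Measure.map_apply (hP.measurable_loc' i) hQ, hP.uniform_loc i, hp]
  have hout : ∀ i, μ (X i ⁻¹' Qᶜ) = ENNReal.ofReal (1 - p) := fun i => by
    rw [Set.preimage_compl, prob_compl_eq_one_sub (hP.measurable_loc' i hQ), hin,
      ENNReal.ofReal_sub _ hp0, ENNReal.ofReal_one]
  have hμA : ∀ S, μ (A S) = ENNReal.ofReal p ^ S.card * ENNReal.ofReal (1 - p) ^ (n - S.card) :=
    fun S => by
    rw [hP.indep_loc.measure_inter_preimage_eq_mul _ fun i _ => hU S i]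
    have : ∀ i, μ (X i ⁻¹' U S i) =
        if i ∈ S then ENNReal.ofReal p else ENNReal.ofReal (1 - p) := fun i => by
      by_cases h : i ∈ S
      · simp only [U, if_pos h, hin]
      · simp only [U, if_neg h, hout]
    simp_rw [this]
    rw [Finset.prod_ite, Finset.prod_const, Finset.prod_const]
    simp [Finset.filter_not, Finset.card_sdiff]
  calc μ {ω | ∀ i, X i ω ∈ Q → act t ω i ≠ none}
      ≤ μ (⋃ S, A S ∩ {ω | ∀ i ∈ S, act t ω i ≠ none}) := by
        refine measure_mono fun ω hω => Set.mem_iUnion.2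
          ⟨Finset.univ.filter fun i => X i ω ∈ Q, Set.mem_iInter₂.2 fun i _ => ?_, fun i hi => ?_⟩
        · by_cases h : X i ω ∈ Q <;> simp [U, h]
        · exact hω i (by simpa using hi)
    _ ≤ ∑ S, μ (A S ∩ {ω | ∀ i ∈ S, act t ω i ≠ none}) := measure_iUnion_fintype_le _ _
    _ ≤ ∑ S : Finset (Fin n), (ENNReal.ofReal (R.sendProb * p)) ^ S.card *
          ENNReal.ofReal (1 - p) ^ (Fintype.card (Fin n) - S.card) := by
        refine Finset.sum_le_sum fun S _ => (hP.measure_inter_senders_le t S (hA S)).trans ?_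
        rw [hμA, ENNReal.ofReal_mul R.sendProb_pos.le, mul_pow, Fintype.card_fin, mul_assoc]
    _ = _ := by
        rw [Fintype.sum_pow_mul_eq_add_pow, ← ENNReal.ofReal_add
          (mul_nonneg R.sendProb_pos.le hp0) (sub_nonneg.2 hp1), Fintype.card_fin,
          ← ENNReal.ofReal_pow (add_nonneg (mul_nonneg R.sendProb_pos.le hp0) (sub_nonneg.2 hp1))]
        congr 2
        ring

/-! ### Growth of the exponential potential -/

theorem measurableSet_transmits (hP : IsRandomPush μ R keep ℱ X H₀ act) (t : ℕ)
    (p : Action n k → Prop) : MeasurableSet[ℱ (t + 1)] {ω | p (act t ω)} := by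
  have : {ω | p (act t ω)} = ⋃ a ∈ {a | p a}, {ω | act t ω = a} := by ext; simp
  rw [this]
  exact @MeasurableSet.biUnion _ _ (ℱ (t + 1)) _ _ (Set.to_countable _)
    fun a _ => hP.measurable_act t a

theorem measurableSet_isLink (hP : IsRandomPush μ R keep ℱ X H₀ act) (t : ℕ) (i j : Fin n) :
    MeasurableSet[ℱ (t + 1)] {ω | IsLink (fun l => X l ω) (act t ω) i j} := by
  have hd := hP.measurable_dist_at (t + 1)
  refine @MeasurableSet.inter _ (ℱ (t + 1)) _ _ (hP.measurableSet_transmits t fun a => a i ≠ none) <|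
    @MeasurableSet.inter _ (ℱ (t + 1)) _ _ (hP.measurableSet_transmits t fun a => a j = none) ?_
  have : {ω | ∀ l, act t ω l = none → dist (X i ω) (X j ω) ≤ dist (X i ω) (X l ω)} =
      ⋂ l, {ω | act t ω l ≠ none} ∪ {ω | dist (X i ω) (X j ω) ≤ dist (X i ω) (X l ω)} := by
    ext ω
    simp only [Set.mem_ofPred_eq, Set.mem_iInter, Set.mem_union]
    exact forall_congr' fun l => imp_iff_not_or
  refine (congrArg (MeasurableSet[ℱ (t + 1)]) this).mpr ?_
  exact @MeasurableSet.iInter _ _ (ℱ (t + 1)) _ _ fun l => @MeasurableSet.union _ (ℱ (t + 1)) _ _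
    (hP.measurableSet_transmits t fun a => a l ≠ none)
    (((hd i j).prodMk (hd i l)) (measurableSet_le measurable_fst measurable_snd))

theorem measurableSet_mem_shortReach (hP : IsRandomPush μ R keep ℱ X H₀ act) (r : ℝ) (c : Fin k)
    (s : Fin n) (t : ℕ) (j : Fin n) : MeasurableSet[ℱ t]
      {ω | j ∈ shortReach r (fun l => X l ω) (fun u => act u ω) c s t} := by
  induction t generalizing j with
  | zero => exact @MeasurableSet.const _ (ℱ 0) (j = s)
  | succ t ih =>
    have ih' := fun j => ℱ.mono t.le_succ _ (ih j)
    refine @MeasurableSet.union _ (ℱ (t + 1)) _ _ (ih' j) ?_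
    have : {ω | ∃ i ∈ shortReach r (fun l => X l ω) (fun u => act u ω) c s t,
        act t ω i = some c ∧ IsLink (fun l => X l ω) (act t ω) i j ∧ dist (X i ω) (X j ω) ≤ r} =
        ⋃ i, {ω | i ∈ shortReach r (fun l => X l ω) (fun u => act u ω) c s t} ∩
          ({ω | act t ω i = some c} ∩ ({ω | IsLink (fun l => X l ω) (act t ω) i j} ∩
            {ω | dist (X i ω) (X j ω) ≤ r})) := by
      ext ω; simp
    refine (congrArg (MeasurableSet[ℱ (t + 1)]) this).mpr ?_
    refine @MeasurableSet.iUnion _ _ (ℱ (t + 1)) _ _ fun i => ?_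
    exact @MeasurableSet.inter _ (ℱ (t + 1)) _ _ (ih' i) <|
      @MeasurableSet.inter _ (ℱ (t + 1)) _ _ (hP.measurableSet_transmits t fun a => a i = some c) <|
      @MeasurableSet.inter _ (ℱ (t + 1)) _ _ (hP.measurableSet_isLink t i j) <|
      hP.measurable_dist_at (t + 1) i j measurableSet_Iic

/-- On the σ-algebra of the past, the bound for events is an inequality between measures, so it
passes to integrals. -/
theorem setLIntegral_transmits_le [IsProbabilityMeasure μ]
    (hP : IsRandomPush μ R keep ℱ X H₀ act) {w : ℕ} (hw : 0 < w)
    (hH : ∀ᵐ ω ∂μ, ∀ i, w ≤ (H₀ ω i).card) (t : ℕ) (i : Fin n) (c : Fin k)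
    {f : Ω → ℝ≥0∞} (hf : Measurable[ℱ t] f) :
    ∫⁻ ω in {ω | act t ω i = some c}, f ω ∂μ ≤
      ENNReal.ofReal (R.sendProb / w) * ∫⁻ ω, f ω ∂μ := by
  have hC : MeasurableSet {ω | act t ω i = some c} :=
    ℱ.le _ _ (hP.measurableSet_transmits t fun a => a i = some c)
  rw [← lintegral_trim (ℱ.le t) hf, ← lintegral_trim (ℱ.le t) hf, ← smul_eq_mul,
    ← lintegral_smul_measure]
  refine lintegral_mono' (Measure.le_intro fun A hA _ => ?_) le_rfl
  rw [trim_measurableSet_eq (ℱ.le t) hA, Measure.restrict_apply (ℱ.le t _ hA),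
    Measure.smul_apply, trim_measurableSet_eq (ℱ.le t) hA]
  exact hP.measure_inter_transmits_le hw hH t i c hA

end IsRandomPush

open Classical in
/-- The sum of `exp (l * d)` over the nodes of `shortReach`, where `d` is the distance to `s`. -/
noncomputable def potential (l r : ℝ) (x : Fin n → Plane) (a : ℕ → Action n k) (c : Fin k)
    (s : Fin n) (t : ℕ) : ℝ≥0∞ :=
  ∑ j, if j ∈ shortReach r x a c s t then ENNReal.ofReal (Real.exp (l * dist (x s) (x j))) else 0

namespace IsRandomPush

theorem measurable_ite_shortReach (hP : IsRandomPush μ R keep ℱ X H₀ act) (l r : ℝ) (c : Fin k)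
    (s : Fin n) (t : ℕ) (j : Fin n)
    [∀ ω, Decidable (j ∈ shortReach r (fun l => X l ω) (fun u => act u ω) c s t)] :
    Measurable[ℱ t] fun ω =>
      if j ∈ shortReach r (fun l => X l ω) (fun u => act u ω) c s t then
        ENNReal.ofReal (Real.exp (l * dist (X s ω) (X j ω))) else 0 := by
  refine Measurable.ite (hP.measurableSet_mem_shortReach r c s t j) ?_ measurable_const
  exact (by fun_prop : Measurable fun d : ℝ => ENNReal.ofReal (Real.exp (l * d))).comp
    (hP.measurable_dist_at t s j)

theorem measurable_potential (hP : IsRandomPush μ R keep ℱ X H₀ act) (l r : ℝ) (c : Fin k)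
    (s : Fin n) (t : ℕ) : Measurable fun ω =>
      potential l r (fun i => X i ω) (fun u => act u ω) c s t := by
  classical
  exact Finset.measurable_sum _ fun j _ =>
    (hP.measurable_ite_shortReach l r c s t j).mono (ℱ.le t) le_rfl

end IsRandomPush

open Classical in
-- Charge each newly reached node to its transmitter. The triangle inequality bounds the ratio of
-- weights by `exp (l * r)`, and the absence of ties leaves each transmitter with at most one
-- charge.
theorem potential_succ_le {l r : ℝ} (hl : 0 ≤ l) {x : Fin n → Plane}
    (hx : ∀ i j l, i ≠ j → l ≠ j → dist (x i) (x j) ≠ dist (x i) (x l))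
    (a : ℕ → Action n k) (c : Fin k) (s : Fin n) (t : ℕ) :
    potential l r x a c s (t + 1) ≤ potential l r x a c s t +
      ∑ i, ENNReal.ofReal (Real.exp (l * r)) * (if a t i = some c then
        (if i ∈ shortReach r x a c s t then
          ENNReal.ofReal (Real.exp (l * dist (x s) (x i))) else 0) else 0) := by
  set J := shortReach r x a c s t with hJ
  let φ : Fin n → ℝ≥0∞ := fun j => ENNReal.ofReal (Real.exp (l * dist (x s) (x j)))
  let E : Fin n → Fin n → Prop := fun i j =>
    i ∈ J ∧ a t i = some c ∧ IsLink x (a t) i j ∧ dist (x i) (x j) ≤ r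
  have h1 : ∀ j, (if j ∈ shortReach r x a c s (t + 1) then φ j else 0) ≤
      (if j ∈ J then φ j else 0) + ∑ i, if E i j then φ j else 0 := fun j => by
    split_ifs with h hj hj
    · exact le_self_add
    · rw [zero_add]
      obtain ⟨i, hi, h⟩ := h.resolve_left hj
      refine le_trans ?_ (Finset.single_le_sum (f := fun i => if E i j then φ j else 0)
        (fun _ _ => zero_le) (Finset.mem_univ i))
      exact (if_pos (show E i j from ⟨hi, h⟩)).ge
    · exact zero_le
    · exact zero_le
  refine (Finset.sum_le_sum fun j _ => h1 j).trans ?_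
  rw [Finset.sum_add_distrib, Finset.sum_comm]
  refine add_le_add le_rfl (Finset.sum_le_sum fun i _ => ?_)
  by_cases hne : ∃ j, E i j
  · obtain ⟨j, hi, hc, hL, hr⟩ := hne
    rw [Finset.sum_eq_single j]
    · simp only [if_pos hc, if_pos hi]
      rw [← ENNReal.ofReal_mul (Real.exp_nonneg _), ← Real.exp_add]
      split_ifs
      · refine ENNReal.ofReal_le_ofReal (Real.exp_le_exp.2 ?_)
        rw [← mul_add]
        refine mul_le_mul_of_nonneg_left ?_ hl
        linarith [dist_triangle (x s) (x i) (x j)]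
      · exact zero_le
    · intro j' _ hj'
      refine if_neg fun ⟨_, _, hL', _⟩ => ?_
      have hij : i ≠ j' := fun h => hL'.1 (h ▸ hL'.2.1)
      exact hx i j' j hij hj'.symm (le_antisymm (hL'.2.2 j hL.2.1) (hL.2.2 j' hL'.2.1))
    · simp
  · rw [Finset.sum_eq_zero fun j _ => if_neg fun h => hne ⟨j, h⟩]
    exact zero_le

namespace IsRandomPush

theorem lintegral_potential_le [IsProbabilityMeasure μ] (hP : IsRandomPush μ R keep ℱ X H₀ act)
    {w : ℕ} (hw : 0 < w) (hH : ∀ᵐ ω ∂μ, ∀ i, w ≤ (H₀ ω i).card) {l r : ℝ} (hl : 0 ≤ l)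
    (c : Fin k) (s : Fin n) (t : ℕ) :
    ∫⁻ ω, potential l r (fun i => X i ω) (fun u => act u ω) c s t ∂μ ≤
      ENNReal.ofReal ((1 + Real.exp (l * r) * (R.sendProb / w)) ^ t) := by
  classical
  have hq : 0 ≤ R.sendProb / w := div_nonneg R.sendProb_pos.le (Nat.cast_nonneg w)
  have hE := Real.exp_nonneg (l * r)
  induction t with
  | zero =>
    have : ∀ ω, potential l r (fun i => X i ω) (fun u => act u ω) c s 0 = 1 := fun ω => by
      simp [potential, shortReach]
    simp [this]
  | succ t ih =>
    let g : Fin n → Ω → ℝ≥0∞ := fun j ω =>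
      if j ∈ shortReach r (fun l => X l ω) (fun u => act u ω) c s t then
        ENNReal.ofReal (Real.exp (l * dist (X s ω) (X j ω))) else 0
    have hg : ∀ j, Measurable[ℱ t] (g j) := fun j => hP.measurable_ite_shortReach l r c s t j
    have hg' : ∀ j, Measurable (g j) := fun j => (hg j).mono (ℱ.le t) le_rfl
    have hC : ∀ i, MeasurableSet {ω | act t ω i = some c} := fun i =>
      ℱ.le _ _ (hP.measurableSet_transmits t fun a => a i = some c)
    have hite : ∀ i, (fun ω => if act t ω i = some c then g i ω else 0) =
        {ω | act t ω i = some c}.indicator (g i) := fun i => by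
      ext ω; simp [Set.indicator_apply]
    calc ∫⁻ ω, potential l r (fun i => X i ω) (fun u => act u ω) c s (t + 1) ∂μ
        ≤ ∫⁻ ω, (potential l r (fun i => X i ω) (fun u => act u ω) c s t +
            ∑ i, ENNReal.ofReal (Real.exp (l * r)) *
              (if act t ω i = some c then g i ω else 0)) ∂μ := by
          refine lintegral_mono_ae ?_
          filter_upwards [hP.ae_dist_ne] with ω hω
          exact potential_succ_le hl hω _ c s t
      _ = ∫⁻ ω, potential l r (fun i => X i ω) (fun u => act u ω) c s t ∂μ +
            ∑ i, ENNReal.ofReal (Real.exp (l * r)) *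
              ∫⁻ ω in {ω | act t ω i = some c}, g i ω ∂μ := by
          rw [lintegral_add_left (hP.measurable_potential l r c s t), lintegral_finsetSum]
          · congr 1
            refine Finset.sum_congr rfl fun i _ => ?_
            rw [lintegral_const_mul' _ _ ENNReal.ofReal_ne_top, hite, lintegral_indicator (hC i)]
          · intro i _
            refine Measurable.const_mul ?_ _
            rw [hite]
            exact (hg' i).indicator (hC i)
      _ ≤ ∫⁻ ω, potential l r (fun i => X i ω) (fun u => act u ω) c s t ∂μ +
            ∑ i, ENNReal.ofReal (Real.exp (l * r)) *
              (ENNReal.ofReal (R.sendProb / w) * ∫⁻ ω, g i ω ∂μ) := by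
          gcongr with i
          exact hP.setLIntegral_transmits_le hw hH t i c (hg i)
      _ = ENNReal.ofReal (1 + Real.exp (l * r) * (R.sendProb / w)) *
            ∫⁻ ω, potential l r (fun i => X i ω) (fun u => act u ω) c s t ∂μ := by
          simp_rw [← mul_assoc]
          rw [← Finset.mul_sum, ← lintegral_finsetSum _ fun i _ => hg' i,
            ENNReal.ofReal_add zero_le_one (mul_nonneg hE hq), add_mul, ENNReal.ofReal_one, one_mul,
            ENNReal.ofReal_mul hE]
          rfl
      _ ≤ _ := by
          rw [pow_succ', ENNReal.ofReal_mul (by positivity)]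
          gcongr

/-- Markov's inequality: one reached node at distance `D` already makes the potential at least `exp
(l * D)`. -/
theorem measure_far_le [IsProbabilityMeasure μ] (hP : IsRandomPush μ R keep ℱ X H₀ act)
    {w : ℕ} (hw : 0 < w) (hH : ∀ᵐ ω ∂μ, ∀ i, w ≤ (H₀ ω i).card) {l r : ℝ} (hl : 0 ≤ l)
    (c : Fin k) (s : Fin n) (t : ℕ) (D : ℝ) :
    μ {ω | ∃ j ∈ shortReach r (fun i => X i ω) (fun u => act u ω) c s t,
        D ≤ dist (X s ω) (X j ω)} ≤
      ENNReal.ofReal (Real.exp (-(l * D)) *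
        (1 + Real.exp (l * r) * (R.sendProb / w)) ^ t) := by
  classical
  have hM := (mul_meas_ge_le_lintegral (hP.measurable_potential l r c s t)
    (ENNReal.ofReal (Real.exp (l * D)))).trans (hP.lintegral_potential_le hw hH hl c s t)
  have hsub : {ω | ∃ j ∈ shortReach r (fun i => X i ω) (fun u => act u ω) c s t,
        D ≤ dist (X s ω) (X j ω)} ⊆ {ω | ENNReal.ofReal (Real.exp (l * D)) ≤
          potential l r (fun i => X i ω) (fun u => act u ω) c s t} := by
    rintro ω ⟨j, hj, hD⟩
    refine le_trans ?_ (Finset.single_le_sum (f := fun j =>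
      if j ∈ shortReach r (fun i => X i ω) (fun u => act u ω) c s t then
        ENNReal.ofReal (Real.exp (l * dist (X s ω) (X j ω))) else 0)
      (fun _ _ => zero_le) (Finset.mem_univ j))
    simp only [if_pos hj]
    exact ENNReal.ofReal_le_ofReal (Real.exp_le_exp.2 (mul_le_mul_of_nonneg_left hD hl))
  refine (measure_mono hsub).trans ?_
  rw [ENNReal.ofReal_mul (Real.exp_nonneg _)]
  refine le_trans (le_of_eq ?_) (mul_le_mul_right hM _)
  rw [← mul_assoc, ← ENNReal.ofReal_mul (Real.exp_nonneg _), ← Real.exp_add]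
  simp

end IsRandomPush

/-! ### A grid on the unit square -/

/-- The cells of the grid that divides the unit square into `m ^ 2` squares. -/
def cell (m : ℕ) (p : Fin 2 → Fin m) : Set Plane :=
  {x | ∀ c, x c ∈ Set.Icc ((p c : ℝ) / m) (((p c : ℝ) + 1) / m)}

theorem cell_subset_unitSquare (m : ℕ) (p : Fin 2 → Fin m) : cell m p ⊆ unitSquare := by
  intro x hx c
  have hm : (0 : ℝ) < m := by exact_mod_cast (p c).pos
  refine ⟨le_trans (by positivity) (hx c).1, (hx c).2.trans ?_⟩
  rw [div_le_one hm]
  exact_mod_cast (p c).isLt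

theorem cell_eq_preimage (m : ℕ) (p : Fin 2 → Fin m) :
    cell m p = (MeasurableEquiv.toLp 2 (Fin 2 → ℝ)).symm ⁻¹'
      Set.Icc (fun c => (p c : ℝ) / m) (fun c => ((p c : ℝ) + 1) / m) := by
  ext x
  exact ⟨fun h => ⟨fun c => (h c).1, fun c => (h c).2⟩, fun h c => ⟨h.1 c, h.2 c⟩⟩

theorem measurableSet_cell (m : ℕ) (p : Fin 2 → Fin m) : MeasurableSet (cell m p) := by
  rw [cell_eq_preimage]
  exact (MeasurableEquiv.measurable _) measurableSet_Icc

theorem volume_restrict_cell (m : ℕ) (p : Fin 2 → Fin m) :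
    volume.restrict unitSquare (cell m p) = ENNReal.ofReal (1 / (m : ℝ) ^ 2) := by
  rw [Measure.restrict_eq_self _ (cell_subset_unitSquare m p), cell_eq_preimage,
    (EuclideanSpace.volume_preserving_symm_measurableEquiv_toLp (Fin 2)).measure_preimage
      measurableSet_Icc.nullMeasurableSet, Real.volume_Icc_pi, Fin.prod_univ_two,
    ← ENNReal.ofReal_mul (by rw [← sub_div]; simp)]
  congr 1
  ring

theorem exists_mem_cell {m : ℕ} (hm : 0 < m) {x : Plane} (hx : x ∈ unitSquare) :
    ∃ p, x ∈ cell m p := by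
  have hm' : (0 : ℝ) < m := by exact_mod_cast hm
  -- The minimum handles a coordinate equal to `1`, which belongs to the last closed cell.
  refine ⟨fun c => ⟨min ⌊x c * m⌋₊ (m - 1), by omega⟩, fun c => ?_⟩
  have h0 : 0 ≤ x c * m := mul_nonneg (hx c).1 hm'.le
  rw [Set.mem_Icc, div_le_iff₀ hm', le_div_iff₀ hm']
  refine ⟨le_trans (by exact_mod_cast min_le_left _ _) (Nat.floor_le h0), ?_⟩
  rcases le_total ⌊x c * m⌋₊ (m - 1) with h | h
  · simpa [min_eq_left h] using (Nat.lt_floor_add_one (x c * m)).le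
  · simp only [min_eq_right h]
    have : ((m - 1 : ℕ) : ℝ) + 1 = m := by exact_mod_cast Nat.sub_add_cancel hm
    rw [this]
    exact mul_le_of_le_one_left hm'.le (hx c).2

theorem dist_le_of_mem_cell {m : ℕ} {p : Fin 2 → Fin m} {x y : Plane} (hx : x ∈ cell m p)
    (hy : y ∈ cell m p) : dist x y ≤ 2 / m := by
  have hc : ∀ c, dist (x c) (y c) ^ 2 ≤ (1 / (m : ℝ)) ^ 2 := fun c => by
    refine pow_le_pow_left₀ dist_nonneg ?_ 2
    have h1 := Real.dist_le_of_mem_Icc (hx c) (hy c)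
    refine h1.trans (le_of_eq ?_)
    ring
  rw [EuclideanSpace.dist_eq, Fin.sum_univ_two]
  refine Real.sqrt_le_iff.2 ⟨by positivity, ?_⟩
  have : (2 / (m : ℝ)) ^ 2 = 4 * (1 / (m : ℝ)) ^ 2 := by ring
  nlinarith [hc 0, hc 1, sq_nonneg (1 / (m : ℝ))]

theorem half_le_dist_of_mem_corner_cells {m : ℕ} (hm : 4 ≤ m) {p q : Fin 2 → Fin m}
    (hp : (p 0 : ℕ) = 0) (hq : (q 0 : ℕ) = m - 1) {x y : Plane} (hx : x ∈ cell m p)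
    (hy : y ∈ cell m q) : 1 / 2 ≤ dist x y := by
  have hm' : (4 : ℝ) ≤ m := by exact_mod_cast hm
  have h1 : x 0 ≤ 1 / m := by simpa [hp] using (hx 0).2
  have h2 : ((m - 1 : ℕ) : ℝ) / m ≤ y 0 := by simpa [hq] using (hy 0).1
  rw [Nat.cast_sub (by omega), Nat.cast_one, sub_div, div_self (by positivity)] at h2
  have h3 : 1 / (m : ℝ) ≤ 1 / 4 := one_div_le_one_div_of_le (by norm_num) hm'
  have h4 : |x 0 - y 0| ≤ dist x y := by
    rw [dist_eq_norm]
    simpa using PiLp.norm_apply_le (x - y) 0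
  have := neg_le_abs (x 0 - y 0)
  linarith

/-! ### The probability that everybody is informed early -/

theorem exists_far_mem_shortReach (hkeep : ∀ j s, keep j s ⊆ s) {x : Fin n → Plane}
    (hx : ∀ i, x i ∈ unitSquare) {h₀ : Holdings n k} {a : ℕ → Action n k} {c : Fin k} {m : ℕ}
    (hm : 4 ≤ m) {s : Fin n} (hs : ∀ i, c ∈ h₀ i → i = s)
    (ha : ∀ u i, a u i = some c → c ∈ R.holdings keep x h₀ a u i) {T : ℕ}
    (hcell : ∀ t ≤ T, ∀ p : Fin 2 → Fin m, ∃ i, x i ∈ cell m p ∧ a t i = none)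
    (hall : ∀ i, c ∈ R.holdings keep x h₀ a T i) :
    ∃ j ∈ shortReach (2 / m) x a c s T, 1 / 4 ≤ dist (x s) (x j) := by
  have hreach : ∀ j, j ∈ shortReach (2 / m) x a c s T := fun j => by
    refine mem_shortReach_of_mem_holdings R hkeep hs ha T (fun u hu i j hL => ?_) j (hall j)
    obtain ⟨p, hp⟩ := exists_mem_cell (by omega : 0 < m) (hx i)
    obtain ⟨l, hl, hr⟩ := hcell u hu.le p
    exact (hL.2.2 l hr).trans (dist_le_of_mem_cell hp hl)
  -- Here `hcell` only supplies nodes in two corner cells. Two nodes at distance at least `1 / 2`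
  -- cannot both be within less than `1 / 4` of the source.
  obtain ⟨i, hi, -⟩ := hcell 0 T.zero_le fun _ => ⟨0, by omega⟩
  obtain ⟨j, hj, -⟩ := hcell 0 T.zero_le fun _ => ⟨m - 1, by omega⟩
  have hij := half_le_dist_of_mem_corner_cells hm rfl rfl hi hj
  by_contra! hcon
  have h1 := hcon i (hreach i)
  have h2 := hcon j (hreach j)
  linarith [dist_triangle_left (x i) (x j) (x s)]

theorem IsRandomPush.measure_all_informed_le [IsProbabilityMeasure μ]
    (hP : IsRandomPush μ R keep ℱ X H₀ act) (hkeep : ∀ j s, keep j s ⊆ s) {w : ℕ} (hw : 0 < w)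
    (hH : ∀ᵐ ω ∂μ, ∀ i, w ≤ (H₀ ω i).card) {c : Fin k}
    (hc : ∀ᵐ ω ∂μ, ∃! i, c ∈ H₀ ω i) {m : ℕ} (hm : 4 ≤ m) (T : ℕ) :
    μ.real {ω | ∀ i, c ∈ past R keep X H₀ act T ω i} ≤
      (T + 1) * m ^ 2 * (1 - (1 - R.sendProb) * (1 / m ^ 2)) ^ n +
        n * (Real.exp (-(m / 8)) * (1 + Real.exp 1 * (R.sendProb / w)) ^ T) := by
  have hm' : (4 : ℝ) ≤ m := by exact_mod_cast hm
  have hθ := R.sendProb_pos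
  have hθ' := R.sendProb_lt
  have hp1 : 1 / (m : ℝ) ^ 2 ≤ 1 := by
    rw [div_le_one (by positivity)]; nlinarith
  have hb0 : 0 ≤ 1 - (1 - R.sendProb) * (1 / (m : ℝ) ^ 2) := by
    have : 0 ≤ 1 / (m : ℝ) ^ 2 := by positivity
    nlinarith
  let bad : ℕ → (Fin 2 → Fin m) → Set Ω := fun t p => {ω | ∀ i, X i ω ∈ cell m p → act t ω i ≠ none}
  -- The source is random and may depend on the locations, so the union bound runs over all `n`
  -- candidates.
  let far : Fin n → Set Ω := fun s =>
    {ω | ∃ j ∈ shortReach (2 / m) (fun i => X i ω) (fun u => act u ω) c s T,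
      1 / 4 ≤ dist (X s ω) (X j ω)}
  have hsub : {ω | ∀ i, c ∈ past R keep X H₀ act T ω i} ≤ᵐ[μ]
      ((⋃ t ∈ Finset.range (T + 1), ⋃ p, bad t p) ∪ ⋃ s, far s : Set Ω) := by
    filter_upwards [hc, hP.ae_mem_unitSquare, hP.ae_mem_past] with ω hω hx ha hall
    obtain ⟨s, -, hs⟩ := hω
    by_contra hcon
    refine hcon ?_
    by_cases hbad : ω ∈ ⋃ t ∈ Finset.range (T + 1), ⋃ p, bad t p
    · exact Or.inl hbad
    · refine Or.inr (Set.mem_iUnion.2 ⟨s, ?_⟩)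
      refine exists_far_mem_shortReach hkeep hx hm hs (fun u i h => ha u i c h) (fun t ht p => ?_)
        hall
      by_contra! hno
      exact hbad (Set.mem_iUnion₂.2 ⟨t, Finset.mem_range.2 (by omega), Set.mem_iUnion.2
        ⟨p, fun i hi => hno i hi⟩⟩)
  -- With `l = m / 2` a hop of maximal length multiplies the weight by `exp 1`, and distance `1 / 4`
  -- gains `exp (m / 8)`.
  have hlr : (m : ℝ) / 2 * (2 / m) = 1 := by field_simp
  have hlD : (m : ℝ) / 2 * (1 / 4) = m / 8 := by ring
  have hfar0 : 0 ≤ Real.exp (-(m / 8 : ℝ)) * (1 + Real.exp 1 * (R.sendProb / w)) ^ T := by positivity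
  have hbad0 : 0 ≤ (T + 1) * (m : ℝ) ^ 2 *
      (1 - (1 - R.sendProb) * (1 / (m : ℝ) ^ 2)) ^ n :=
    mul_nonneg (by positivity) (pow_nonneg hb0 n)
  have hfar1 := mul_nonneg n.cast_nonneg hfar0
  refine ENNReal.toReal_le_of_le_ofReal (add_nonneg hbad0 hfar1) ?_
  refine (measure_mono_ae hsub).trans ((measure_union_le _ _).trans ?_)
  rw [ENNReal.ofReal_add hbad0 hfar1]
  refine add_le_add ?_ ?_
  · refine (measure_biUnion_finset_le _ _).trans ((Finset.sum_le_card_nsmul _ _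
      (m ^ 2 • ENNReal.ofReal ((1 - (1 - R.sendProb) * (1 / (m : ℝ) ^ 2)) ^ n)) fun t _ => ?_).trans
      (le_of_eq ?_))
    · refine (measure_iUnion_fintype_le _ _).trans ((Finset.sum_le_card_nsmul _ _ _ fun p _ =>
        hP.measure_all_senders_le t (measurableSet_cell m p) (volume_restrict_cell m p)
          (by positivity) hp1).trans (le_of_eq ?_))
      simp
    · rw [Finset.card_range, ← ENNReal.ofReal_nsmul, ← ENNReal.ofReal_nsmul]
      simp [mul_assoc]
  · refine (measure_iUnion_fintype_le _ _).trans ((Finset.sum_le_card_nsmul _ _ _ fun s _ =>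
      hP.measure_far_le hw hH (l := m / 2) (r := 2 / m) (by positivity) c s T (1 / 4)).trans
      (le_of_eq ?_))
    rw [hlr, hlD, Finset.card_univ, Fintype.card_fin, ← ENNReal.ofReal_nsmul, nsmul_eq_mul]

/-! ### Asymptotics -/

theorem SuperPolylog.tendsto_atTop {w : ℕ → ℕ} (hw : SuperPolylog w) :
    Tendsto (fun n => (w n : ℝ)) atTop atTop := by
  have h := (hw 1).bound (c := 1) one_pos
  refine tendsto_atTop_mono' atTop ?_ (Real.tendsto_log_atTop.comp tendsto_natCast_atTop_atTop)
  filter_upwards [h] with n hn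
  simp only [pow_one, one_mul, Real.norm_natCast] at hn
  exact (Real.le_norm_self _).trans hn

/-- The empty-receiver term is at most `2 * n ^ 3 * n ^ (-8)`. For the other, `m / 8 ≥ s / 64` while
the growth contributes at most `s / 128`; the net `s / 128` is at least `4 * log n`, which explains
`512 = 4 * 128`. -/
theorem failure_bound_lt {n w m T : ℕ} {θ ε : ℝ} (hθ0 : 0 < θ) (hθ : θ < 1 / 2)
    (hn4 : 4 ≤ n) (hL : 1 ≤ Real.log n) (hlog : 512 ^ 2 * Real.log n ^ 3 ≤ n) (hε : 0 < ε)
    (hw : 1 ≤ w) (hwn : w ≤ n) (hwε : 128 ≤ (w : ℝ) ^ ε)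
    (hm : m = ⌊√(n / Real.log n) / 4⌋₊)
    (hT : (T : ℝ) ≤ (w : ℝ) ^ (1 - ε) * √(n / (128 * Real.log n))) :
    4 ≤ m ∧ (T + 1) * m ^ 2 * (1 - (1 - θ) * (1 / m ^ 2)) ^ n +
        n * (Real.exp (-(m / 8)) * (1 + Real.exp 1 * (θ / w)) ^ T) < ((n : ℝ) ^ 2)⁻¹ := by
  set L := Real.log n with hLdef
  set s := √(n / L) with hs
  have hn : (4 : ℝ) ≤ n := by exact_mod_cast hn4
  have hn0 : (0 : ℝ) < n := by linarith
  have hL0 : 0 < L := by linarith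
  have hW : (1 : ℝ) ≤ w := by exact_mod_cast hw
  have hWn : (w : ℝ) ≤ n := by exact_mod_cast hwn
  have hs2 : s ^ 2 = n / L := Real.sq_sqrt (by positivity)
  have hsL : 512 * L ≤ s := by
    refine Real.le_sqrt_of_sq_le ?_
    rw [le_div_iff₀ hL0]
    calc (512 * L) ^ 2 * L = 512 ^ 2 * L ^ 3 := by ring
      _ ≤ (n : ℝ) := hlog
  have hmle : (m : ℝ) ≤ s / 4 := by rw [hm]; exact Nat.floor_le (by positivity)
  have hmge : s / 8 ≤ m := by
    have := Nat.lt_floor_add_one (s / 4)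
    rw [← hm] at this
    linarith
  have hm4 : (4 : ℝ) ≤ m := by linarith
  have hm2 : (m : ℝ) ^ 2 ≤ n / (16 * L) := by
    calc (m : ℝ) ^ 2 ≤ (s / 4) ^ 2 := by gcongr
      _ = s ^ 2 / 16 := by ring
      _ = n / (16 * L) := by rw [hs2, div_div, mul_comm]
  have hexp : ∀ j : ℕ, Real.exp (-(j * L)) = ((n : ℝ) ^ j)⁻¹ := fun j => by
    rw [Real.exp_neg, Real.exp_nat_mul, Real.exp_log hn0]
  refine ⟨by exact_mod_cast hm4, ?_⟩
  have hfirst : (T + 1) * (m : ℝ) ^ 2 * (1 - (1 - θ) * (1 / (m : ℝ) ^ 2)) ^ n ≤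
      ((n : ℝ) ^ 2)⁻¹ / 4 := by
    -- The exponent `8` is half of `16`, because `1 - θ > 1 / 2`.
    have hpow : (1 - (1 - θ) * (1 / (m : ℝ) ^ 2)) ^ n ≤ ((n : ℝ) ^ 8)⁻¹ := by
      have hinv : 16 * L / n ≤ 1 / (m : ℝ) ^ 2 := by
        rw [le_div_iff₀ (by positivity)]
        calc 16 * L / n * (m : ℝ) ^ 2 ≤ 16 * L / n * (n / (16 * L)) := by gcongr
          _ = 1 := by field_simp
      have h1 : 1 / (m : ℝ) ^ 2 ≤ 1 := by
        rw [div_le_one (by positivity)]; nlinarith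
      calc (1 - (1 - θ) * (1 / (m : ℝ) ^ 2)) ^ n
          ≤ Real.exp (-(8 * L / n)) ^ n := by
            refine pow_le_pow_left₀ ?_ ?_ n
            · have : 0 ≤ 1 / (m : ℝ) ^ 2 := by positivity
              nlinarith
            · refine le_trans ?_ (Real.one_sub_le_exp_neg _)
              have : 8 * L / n = 1 / 2 * (16 * L / n) := by ring
              rw [this]
              have : 0 ≤ 16 * L / n := by positivity
              nlinarith
        _ = ((n : ℝ) ^ 8)⁻¹ := by
            rw [← Real.exp_nat_mul, ← hexp 8]
            congr 1
            push_cast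
            field_simp
    have hT2 : (T : ℝ) + 1 ≤ 2 * n ^ 2 := by
      have h1 : (w : ℝ) ^ (1 - ε) ≤ n := by
        calc (w : ℝ) ^ (1 - ε) ≤ (w : ℝ) ^ (1 : ℝ) :=
              Real.rpow_le_rpow_of_exponent_le hW (by linarith)
          _ ≤ n := by rwa [Real.rpow_one]
      have h2 : √(n / (128 * L)) ≤ n := by
        rw [Real.sqrt_le_left hn0.le, div_le_iff₀ (by positivity)]
        nlinarith [mul_pos hn0 hn0, mul_le_mul_of_nonneg_left hL (sq_nonneg (n : ℝ))]
      have h3 : (T : ℝ) ≤ n * n := hT.trans (mul_le_mul h1 h2 (Real.sqrt_nonneg _) hn0.le)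
      nlinarith
    have hmn : (m : ℝ) ^ 2 ≤ n := hm2.trans (div_le_self hn0.le (by linarith))
    calc (T + 1) * (m : ℝ) ^ 2 * (1 - (1 - θ) * (1 / (m : ℝ) ^ 2)) ^ n
        ≤ (T + 1) * (m : ℝ) ^ 2 * ((n : ℝ) ^ 8)⁻¹ :=
          mul_le_mul_of_nonneg_left hpow (by positivity)
      _ ≤ 2 * n ^ 2 * n * ((n : ℝ) ^ 8)⁻¹ := by gcongr
      _ = ((n : ℝ) ^ 2)⁻¹ * (2 / n ^ 3) := by field_simp
      _ ≤ ((n : ℝ) ^ 2)⁻¹ * (1 / 4) := by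
          refine mul_le_mul_of_nonneg_left ?_ (by positivity)
          rw [div_le_div_iff₀ (by positivity) (by norm_num)]
          have : (4 : ℝ) ^ 3 ≤ n ^ 3 := by gcongr
          linarith
      _ = ((n : ℝ) ^ 2)⁻¹ / 4 := by ring
  have hsecond : n * (Real.exp (-(m / 8 : ℝ)) * (1 + Real.exp 1 * (θ / w)) ^ T) ≤
      ((n : ℝ) ^ 2)⁻¹ / 4 := by
    -- The factor `w ^ (-ε)` left over from `T / w` absorbs all constants once `w ^ ε ≥ 128`.
    have hTw : T * (Real.exp 1 * (θ / w)) ≤ s / 128 := by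
      have he : Real.exp 1 * θ ≤ 2 := by
        nlinarith [Real.exp_one_lt_d9, Real.exp_pos 1]
      have hq : √(n / (128 * L)) ≤ s / 2 := by
        refine Real.sqrt_le_iff.2 ⟨by positivity, ?_⟩
        rw [div_pow, hs2, div_div]
        exact div_le_div_of_nonneg_left hn0.le (by positivity) (by nlinarith)
      calc T * (Real.exp 1 * (θ / w)) = Real.exp 1 * θ * (T / w) := by ring
        _ ≤ 2 * ((w : ℝ) ^ (1 - ε) * (s / 2) / w) := by
            gcongr
            exact hT.trans (by gcongr)
        _ = s / (w : ℝ) ^ ε := by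
            rw [Real.rpow_sub (by linarith), Real.rpow_one]
            field_simp
        _ ≤ s / 128 := by gcongr
    calc n * (Real.exp (-(m / 8 : ℝ)) * (1 + Real.exp 1 * (θ / w)) ^ T)
        ≤ n * (Real.exp (-(m / 8 : ℝ)) * Real.exp (s / 128)) := by
          gcongr
          calc (1 + Real.exp 1 * (θ / w)) ^ T ≤ Real.exp (Real.exp 1 * (θ / w)) ^ T := by
                gcongr
                linarith [Real.add_one_le_exp (Real.exp 1 * (θ / w))]
            _ ≤ Real.exp (s / 128) := by
                rw [← Real.exp_nat_mul]
                exact Real.exp_le_exp.2 hTw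
      _ ≤ n * ((n : ℝ) ^ 4)⁻¹ := by
          rw [← Real.exp_add, ← hexp 4]
          gcongr
          push_cast
          linarith
      _ = ((n : ℝ) ^ 2)⁻¹ * (1 / n) := by field_simp
      _ ≤ ((n : ℝ) ^ 2)⁻¹ * (1 / 4) := by gcongr
      _ = ((n : ℝ) ^ 2)⁻¹ / 4 := by ring
  have : 0 < ((n : ℝ) ^ 2)⁻¹ := by positivity
  linarith

end Gossip

/-! ### The lower bound on the spreading time -/

theorem theorem2 (R : Gossip.Radio) (w : ℕ → ℕ) (hw : Gossip.SuperPolylog w)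
    (ε : ℝ) (hε : 0 < ε) :
    ∀ᶠ n : ℕ in atTop, ∀ (k : ℕ), k ≤ n →
      ∀ (keep : Gossip.ReceptionRule n), (∀ j s, keep j s ⊆ s) →
      ∀ (Ω : Type*) [mΩ : MeasurableSpace Ω] (μ : Measure Ω) [IsProbabilityMeasure μ]
        (ℱ : Filtration ℕ mΩ) (X : Fin n → Ω → Gossip.Plane)
        (H₀ : Ω → Gossip.Holdings n k) (act : ℕ → Ω → Gossip.Action n k) (Mstar : Fin k),
        Gossip.IsRandomPush μ R keep ℱ X H₀ act →
        -- exactly one node, the source, possesses the new message at time 0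
        (∀ᵐ ω ∂μ, ∃! i, Mstar ∈ H₀ ω i) →
        -- every node has received at least `w n` of the other messages by time 0
        (∀ᵐ ω ∂μ, ∀ i, w n ≤ ((H₀ ω i).erase Mstar).card) →
        1 - ((n : ℝ) ^ 2)⁻¹ <
          μ.real {ω | ENNReal.ofReal ((w n : ℝ) ^ (1 - ε) * √(n / (128 * Real.log n))) <
            (R.spreadTime keep (fun i => X i ω) (H₀ ω) (fun t => act t ω) Mstar : ℝ≥0∞)} := by

  have hcube : ∀ᶠ n : ℕ in atTop, 512 ^ 2 * Real.log n ^ 3 ≤ n := by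
    have h := ((Real.isLittleO_pow_log_id_atTop (n := 3)).comp_tendsto
      (tendsto_natCast_atTop_atTop (R := ℝ))).bound (c := (512 ^ 2)⁻¹) (by norm_num)
    filter_upwards [h] with n hn
    simp only [Function.comp_apply, id, Real.norm_natCast] at hn
    have := (Real.le_norm_self _).trans hn
    linarith
  have hwtop := hw.tendsto_atTop
  filter_upwards [eventually_ge_atTop 4,
    (Real.tendsto_log_atTop.comp tendsto_natCast_atTop_atTop).eventually_ge_atTop 1, hcube,
    hwtop.eventually_ge_atTop 1,
    ((tendsto_rpow_atTop hε).comp hwtop).eventually_ge_atTop 128] with n hn4 hL hcube hw1 hwε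
    k hk keep hkeep Ω mΩ μ _ ℱ X H₀ act Mstar hP hsrc hheld
  have hw1' : 1 ≤ w n := by exact_mod_cast hw1
  have hH : ∀ᵐ ω ∂μ, ∀ i, w n ≤ (H₀ ω i).card := by
    filter_upwards [hheld] with ω hω i
    exact (hω i).trans (Finset.card_le_card (Finset.erase_subset _ _))
  -- An almost sure property holds at some outcome, where a node holds at least `w n` of the `k ≤ n`
  -- messages.
  have hwn : w n ≤ n := by
    obtain ⟨ω, hω⟩ := hH.exists
    exact (hω ⟨0, by omega⟩).trans ((Finset.card_le_univ _).trans (by simpa using hk))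
  set B := (w n : ℝ) ^ (1 - ε) * √(n / (128 * Real.log n)) with hB
  have hB0 : 0 ≤ B := by positivity
  obtain ⟨hm, hlt⟩ := Gossip.failure_bound_lt R.sendProb_pos R.sendProb_lt hn4 hL hcube hε hw1' hwn
    hwε rfl (Nat.floor_le hB0)
  set S := {ω | ENNReal.ofReal B <
    (R.spreadTime keep (fun i => X i ω) (H₀ ω) (fun t => act t ω) Mstar : ℝ≥0∞)} with hS
  have hSc : μ.real Sᶜ < ((n : ℝ) ^ 2)⁻¹ := by
    refine lt_of_le_of_lt ((measureReal_mono fun ω hω => ?_).trans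
      (hP.measure_all_informed_le hkeep hw1' hH hsrc hm ⌊B⌋₊)) hlt
    exact R.exists_le_of_spreadTime_le hB0 (not_lt.1 hω)
  -- Subadditivity suffices here, so measurability of `S` is not needed.
  have huniv : 1 ≤ μ.real S + μ.real Sᶜ := by
    have := measureReal_union_le (μ := μ) S Sᶜ
    rwa [Set.union_compl_self, probReal_univ] at this
  linarith
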